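/- Let $n\ge 1$, let $S$ be a linear subspace of $\mathbb{R}^n$ of dimension $D$, let $\Pi_S$ be the orthogonal projection of $\mathbb{R}^n$ onto $S$, and let $e_1,\dots,e_n$ be the canonical basis of $\mathbb{R}^n$. Write $|\cdot|_2$ for the Euclidean norm, $|x|_\infty=\max_{1\le i\le n}|x_i|$, and $\Lambda_2(S)=\max_{1\le i\le n}|\Pi_S e_i|_2$. Let $\xi=(\xi_1,\dots,\xi_n)$ be a random vector of $\mathbb{R}^n$ with independent coordinates such that, for some numbers $\sigma,c\ge 0$, $$\log \mathbb{E}\big[e^{\lambda\xi_i}\big]\le \frac{\lambda^2\sigma^2}{2(1-|\lambda|c)}\qquad\text{for all }\lambda\in(-1/c,1/c)\text{ and } i=1,\dots,n$$ (with the convention $1/0=+\infty$; in particular these exponential moments are finite). Let $\kappa=18$. (1) If $(\sigma,c)\ne(0,0)$, then for all $x,u>0$, $$\mathbb{P}\Big[|\Pi_S\xi|_2^2\ge \kappa^2\Big(\sigma^2+\frac{2cu}{\kappa}\Big)(D+x),\ |\Pi_S\xi|_\infty\le u\Big]\le e^{-x}.$$ (2) For all $x>0$, $$\mathbb{P}\big(|\Pi_S\xi|_\infty\ge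 x\big)\le 2n\exp\Big[-\frac{x^2}{2\Lambda_2^2(S)(\sigma^2+cx)}\Big],$$ where the right-hand side is read as $0$ when $\Lambda_2^2(S)(\sigma^2+cx)=0$. -/

import Mathlib

open MeasureTheory ProbabilityTheory

namespace ChiDeviation

noncomputable section

/-- The numerical constant `κ = 18`. -/
def kappa : ℝ := 18

/-- The norm `|x|_∞ = max_i |x_i|` on `ℝⁿ`. -/
def supNorm {n : ℕ} (x : EuclideanSpace ℝ (Fin n)) : ℝ := ⨆ i : Fin n, |x i|

/-- `Λ₂(S) = max_i |Π_S e_i|₂`, where `Π_S` is the orthogonal projection of `ℝⁿ` onto `S` and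
`e_1, …, e_n` is the canonical basis. -/
def Lambda2 {n : ℕ} (S : Submodule ℝ (EuclideanSpace ℝ (Fin n))) : ℝ :=
  ⨆ i : Fin n, ‖S.starProjection (EuclideanSpace.single i (1 : ℝ))‖

/-- `log E[exp (λ X)] ≤ λ² σ² / (2 (1 - |λ| c))` for all `λ ∈ (-1/c, 1/c)`, with `1/0 = +∞`; the
condition on `λ` is written `|λ| c < 1`. The left-hand side is meant to be finite, so the
integrability of `exp (λ X)` is part of the condition. -/
def BernsteinLaplace {Ω : Type*} [MeasurableSpace Ω] (μ : Measure Ω) (X : Ω → ℝ) (σ c : ℝ) : Prop :=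
  ∀ t : ℝ, |t| * c < 1 →
    Integrable (fun ω => Real.exp (t * X ω)) μ ∧
      Real.log (∫ ω, Real.exp (t * X ω) ∂μ) ≤ t ^ 2 * σ ^ 2 / (2 * (1 - |t| * c))

end

end ChiDeviation

namespace ChiDeviation

/-! ### Exponential moments of linear forms -/

/-! For (1), chaining is replaced by a volume argument. Let `K` be the vectors of `S` with norm at
most `L` and coordinates at most `b = L * u / ρ`, and average `exp ⟪ξ, v⟫` over `v ∈ 2K`. The
Bernstein condition bounds the expected integral by `exp ((2L)²σ²) * 2 ^ D * vol K`. On the event,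
`p = (L / ‖Π_S ξ‖) • Π_S ξ` lies in `K`, so `p + K ⊆ 2K`; as `K` is symmetric, the integral over `p
+ K` is at least `exp (L * ρ) * vol K`. Markov's inequality cancels `vol K`
(`measure_le_of_exists_shift`), and the choice of `L` and `ρ` absorbs `2 ^ D`.

For (2), each coordinate of `Π_S ξ` is the linear form `⟪ξ, Π_S e_i⟫`; Chernoff's bound
(`measure_le_inner_le`) and a union bound over `2n` signed coordinates suffice. -/

theorem BernsteinLaplace.mgf_le {Ω : Type*} [MeasurableSpace Ω] {μ : Measure Ω}
    [IsProbabilityMeasure μ] {X : Ω → ℝ} {σ c : ℝ} (h : BernsteinLaplace μ X σ c) {t M : ℝ}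
    (htM : |t| ≤ M) (hc : 0 ≤ c) (hM : M * c < 1) :
    mgf X μ t ≤ Real.exp (t ^ 2 * (σ ^ 2 / (2 * (1 - M * c)))) := by
  have htc : |t| * c ≤ M * c := mul_le_mul_of_nonneg_right htM hc
  obtain ⟨hint, hlog⟩ := h t (htc.trans_lt hM)
  rw [← Real.log_le_iff_le_exp (mgf_pos hint)]
  refine hlog.trans ?_
  rw [mul_div_assoc]
  gcongr

/-- A uniform bound on the weights gives every factor the same denominator, so the bound depends on
`v` only through its Euclidean norm and `M`. -/
theorem lintegral_exp_sum_le {Ω : Type*} [MeasurableSpace Ω] {μ : Measure Ω}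
    [IsProbabilityMeasure μ] {ι : Type*} [Fintype ι] {X : ι → Ω → ℝ}
    (hX : ∀ i, Measurable (X i)) (hindep : iIndepFun X μ) {σ c : ℝ} (hc : 0 ≤ c)
    (hbern : ∀ i, BernsteinLaplace μ (X i) σ c) (v : ι → ℝ) {M : ℝ} (hv : ∀ i, |v i| ≤ M)
    (hM : M * c < 1) :
    ∫⁻ ω, ENNReal.ofReal (Real.exp (∑ i, v i * X i ω)) ∂μ
      ≤ ENNReal.ofReal (Real.exp ((∑ i, v i ^ 2) * (σ ^ 2 / (2 * (1 - M * c))))) := by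
  have hmeas : ∀ i, Measurable (fun ω => v i * X i ω) := fun i => (hX i).const_mul _
  have hind : iIndepFun (fun i ω => v i * X i ω) μ :=
    hindep.comp (fun i x => v i * x) (fun i => measurable_const_mul _)
  have hint : Integrable (fun ω => Real.exp (∑ i, v i * X i ω)) μ := by
    have := hind.integrable_exp_mul_sum (t := 1) hmeas (s := Finset.univ) (fun i _ => by
      simpa using ((hbern i) (v i)
        ((mul_le_mul_of_nonneg_right (hv i) hc).trans_lt hM)).1)
    simpa [Finset.sum_apply] using this
  rw [← ofReal_integral_eq_lintegral_ofReal hint (ae_of_all _ fun _ => (Real.exp_pos _).le)]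
  refine ENNReal.ofReal_le_ofReal ?_
  have hprod := hind.mgf_sum (t := 1) hmeas Finset.univ
  have hmgf : ∀ i, mgf (fun ω => v i * X i ω) μ 1 = mgf (X i) μ (v i) := fun i => by
    simp [mgf]
  simp only [hmgf] at hprod
  have hlhs : mgf (∑ i, fun ω => v i * X i ω) μ 1 = ∫ ω, Real.exp (∑ i, v i * X i ω) ∂μ := by
    simp [mgf, Finset.sum_apply]
  rw [← hlhs, hprod, Finset.sum_mul, Real.exp_sum]
  exact Finset.prod_le_prod (fun i _ => mgf_nonneg) fun i _ => (hbern i).mgf_le (hv i) hc hM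

/-- A variable satisfying the Bernstein condition with `σ = 0` vanishes almost surely. -/
theorem BernsteinLaplace.ae_eq_zero {Ω : Type*} [MeasurableSpace Ω] {μ : Measure Ω}
    [IsProbabilityMeasure μ] {X : Ω → ℝ} {c : ℝ} (hc : 0 ≤ c) (h : BernsteinLaplace μ X 0 c) :
    ∀ᵐ ω ∂μ, X ω = 0 := by
  obtain ⟨t, ht0, htc⟩ : ∃ t : ℝ, 0 < t ∧ t * c < 1 :=
    ⟨(c + 1)⁻¹, by positivity, by rw [inv_mul_lt_iff₀ (by positivity)]; linarith⟩
  have habs : |t| = t := abs_of_pos ht0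
  have h₁ := h t (by rwa [habs])
  have h₂ := h (-t) (by rwa [abs_neg, habs])
  have b₁ := h.mgf_le (t := t) (M := t) habs.le hc htc
  have b₂ := h.mgf_le (t := -t) (M := t) (by rw [abs_neg, habs]) hc htc
  simp only [mgf, ne_eq, OfNat.ofNat_ne_zero, not_false_eq_true, zero_pow, zero_div, mul_zero,
    Real.exp_zero] at b₁ b₂
  -- Both exponentials have mean at most 1, while their sum is `2 cosh (t X) ≥ 2`, with equality
  -- only where `X = 0`.
  have hcosh : ∀ ω, 0 ≤ Real.exp (t * X ω) + Real.exp (-t * X ω) - 2 := fun ω => by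
    have := Real.one_le_cosh (t * X ω)
    rw [Real.cosh_eq] at this
    rw [neg_mul]
    linarith
  have hint : Integrable (fun ω => Real.exp (t * X ω) + Real.exp (-t * X ω) - 2) μ :=
    (h₁.1.add h₂.1).sub (integrable_const _)
  have hzero : ∫ ω, (Real.exp (t * X ω) + Real.exp (-t * X ω) - 2) ∂μ = 0 := by
    refine le_antisymm ?_ (integral_nonneg hcosh)
    have hadd : Integrable (fun ω => Real.exp (t * X ω) + Real.exp (-t * X ω)) μ := h₁.1.add h₂.1
    rw [integral_sub hadd (integrable_const _), integral_add h₁.1 h₂.1]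
    simp only [integral_const, probReal_univ, one_smul]
    linarith
  filter_upwards [(integral_eq_zero_iff_of_nonneg hcosh hint).1 hzero] with ω hω
  by_contra hX
  have := Real.one_lt_cosh.2 (mul_ne_zero ht0.ne' hX)
  rw [Real.cosh_eq, ← neg_mul] at this
  simp only [Pi.zero_apply] at hω
  linarith

/-! ### Mixtures of exponentials over a symmetric set -/

section Mixture

variable {E : Type*} [NormedAddCommGroup E] [NormedSpace ℝ E] [MeasurableSpace E] [BorelSpace E]
  [FiniteDimensional ℝ E]

/-- Averaging over `v` and `-v` replaces the exponential by `cosh (f v) ≥ 1`. -/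
theorem measure_le_setLIntegral_exp_of_symm (ν : Measure E) [ν.IsAddHaarMeasure] {K : Set E}
    (hsymm : ∀ v ∈ K, -v ∈ K) (f : E →ₗ[ℝ] ℝ) :
    ν K ≤ ∫⁻ v in K, ENNReal.ofReal (Real.exp (f v)) ∂ν := by
  have hf : Measurable f := f.continuous_of_finiteDimensional.measurable
  have hK : (fun v : E => -v) ⁻¹' K = K := by
    ext v
    exact ⟨fun h => by simpa using hsymm _ h, fun h => hsymm v h⟩
  have hneg : ∫⁻ v in K, ENNReal.ofReal (Real.exp (-f v)) ∂ν
      = ∫⁻ v in K, ENNReal.ofReal (Real.exp (f v)) ∂ν := by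
    have := (Measure.measurePreserving_neg ν).setLIntegral_comp_preimage_emb
      (MeasurableEquiv.neg E).measurableEmbedding (fun v => ENNReal.ofReal (Real.exp (f v))) K
    have hK' : Neg.neg ⁻¹' K = K := hK
    rw [hK'] at this
    simpa using this
  have hsum : 2 * ν K ≤ 2 * ∫⁻ v in K, ENNReal.ofReal (Real.exp (f v)) ∂ν := by
    calc 2 * ν K = ∫⁻ _ in K, 2 ∂ν := by rw [setLIntegral_const]
      _ ≤ ∫⁻ v in K, (ENNReal.ofReal (Real.exp (f v)) + ENNReal.ofReal (Real.exp (-f v))) ∂ν := by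
          refine lintegral_mono fun v => ?_
          rw [← ENNReal.ofReal_add (Real.exp_pos _).le (Real.exp_pos _).le,
            ← ENNReal.ofReal_ofNat 2]
          refine ENNReal.ofReal_le_ofReal ?_
          have := Real.one_le_cosh (f v)
          rw [Real.cosh_eq] at this
          linarith
      _ = 2 * ∫⁻ v in K, ENNReal.ofReal (Real.exp (f v)) ∂ν := by
          rw [lintegral_add_left (by fun_prop), hneg, two_mul]
  exact (ENNReal.mul_le_mul_iff_right (by norm_num) (by norm_num)).1 hsum

theorem exp_mul_measure_le_setLIntegral (ν : Measure E) [ν.IsAddHaarMeasure] {K L : Set E}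
    (hsymm : ∀ v ∈ K, -v ∈ K) {p : E} (hp : ∀ v ∈ K, p + v ∈ L) (f : E →ₗ[ℝ] ℝ) :
    ENNReal.ofReal (Real.exp (f p)) * ν K ≤ ∫⁻ v in L, ENNReal.ofReal (Real.exp (f v)) ∂ν := by
  have hf : Measurable f := f.continuous_of_finiteDimensional.measurable
  have hshift := (measurePreserving_add_left ν p).setLIntegral_comp_preimage_emb
    (MeasurableEquiv.addLeft p).measurableEmbedding (fun v => ENNReal.ofReal (Real.exp (f v))) L
  calc ENNReal.ofReal (Real.exp (f p)) * ν K
      ≤ ENNReal.ofReal (Real.exp (f p)) * ∫⁻ v in K, ENNReal.ofReal (Real.exp (f v)) ∂ν := by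
        gcongr
        exact measure_le_setLIntegral_exp_of_symm ν hsymm f
    _ = ∫⁻ v in K, ENNReal.ofReal (Real.exp (f (p + v))) ∂ν := by
        rw [← lintegral_const_mul _ (by fun_prop)]
        refine lintegral_congr fun v => ?_
        rw [map_add, Real.exp_add, ENNReal.ofReal_mul (Real.exp_pos _).le]
    _ ≤ ∫⁻ v in (fun x => p + x) ⁻¹' L, ENNReal.ofReal (Real.exp (f (p + v))) ∂ν :=
        lintegral_mono_set hp
    _ = ∫⁻ v in L, ENNReal.ofReal (Real.exp (f v)) ∂ν := hshift

/-- A tail bound for a random linear form obtained by averaging its exponential over the dilate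
`2 • K` of a symmetric set `K`. -/
theorem measure_le_of_exists_shift {Ω : Type*} [MeasurableSpace Ω] (μ : Measure Ω) [SFinite μ]
    (ν : Measure E) [ν.IsAddHaarMeasure] {K L : Set E} (hsymm : ∀ v ∈ K, -v ∈ K)
    (hK : ν K ≠ 0) (hK' : ν K ≠ ⊤) (hL : MeasurableSet L)
    (hKL : ν L ≤ ENNReal.ofReal (2 ^ Module.finrank ℝ E) * ν K)
    (f : Ω → E →ₗ[ℝ] ℝ) (hf : Measurable fun q : Ω × E => f q.1 q.2) {b r : ℝ}
    (hb : ∀ v ∈ L, ∫⁻ ω, ENNReal.ofReal (Real.exp (f ω v)) ∂μ ≤ ENNReal.ofReal (Real.exp b))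
    {A : Set Ω} (hA : ∀ ω ∈ A, ∃ p, (∀ v ∈ K, p + v ∈ L) ∧ r ≤ f ω p) :
    μ A ≤ ENNReal.ofReal (2 ^ Module.finrank ℝ E * Real.exp (b - r)) := by
  set F : Ω → ENNReal := fun ω => ∫⁻ v in L, ENNReal.ofReal (Real.exp (f ω v)) ∂ν with hF
  have hjoint : Measurable fun q : Ω × E => ENNReal.ofReal (Real.exp (f q.1 q.2)) := by fun_prop
  have hFmeas : Measurable F := hjoint.lintegral_prod_right'
  have hFint : ∫⁻ ω, F ω ∂μ
      ≤ ENNReal.ofReal (Real.exp b) * (ENNReal.ofReal (2 ^ Module.finrank ℝ E) * ν K) := by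
    rw [hF, lintegral_lintegral_swap hjoint.aemeasurable]
    calc ∫⁻ v in L, ∫⁻ ω, ENNReal.ofReal (Real.exp (f ω v)) ∂μ ∂ν
        ≤ ∫⁻ _ in L, ENNReal.ofReal (Real.exp b) ∂ν := setLIntegral_mono' hL hb
      _ = ENNReal.ofReal (Real.exp b) * ν L := setLIntegral_const _ _
      _ ≤ _ := by gcongr
  have hsub : A ⊆ {ω | ENNReal.ofReal (Real.exp r) * ν K ≤ F ω} := fun ω hω => by
    obtain ⟨p, hp, hr⟩ := hA ω hω
    refine le_trans ?_ (exp_mul_measure_le_setLIntegral ν hsymm hp (f ω))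
    gcongr
  have hmarkov := (mul_meas_ge_le_lintegral hFmeas (ENNReal.ofReal (Real.exp r) * ν K)).trans hFint
  have hexp : ENNReal.ofReal (Real.exp b) = ENNReal.ofReal (Real.exp r) *
      ENNReal.ofReal (Real.exp (b - r)) := by
    rw [← ENNReal.ofReal_mul (Real.exp_pos _).le, ← Real.exp_add]
    congr 2
    ring
  refine (measure_mono hsub).trans ?_
  rw [ENNReal.ofReal_mul (by positivity)]
  have hr0 : ENNReal.ofReal (Real.exp r) * ν K ≠ 0 :=
    mul_ne_zero (by simpa using Real.exp_pos r) hK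
  have hrtop : ENNReal.ofReal (Real.exp r) * ν K ≠ ⊤ := ENNReal.mul_ne_top ENNReal.ofReal_ne_top hK'
  refine (ENNReal.mul_le_mul_iff_right hr0 hrtop).1 (hmarkov.trans_eq ?_)
  rw [hexp]
  ring

end Mixture

/-! ### Euclidean norm -/

variable {n : ℕ}

theorem abs_le_supNorm (x : EuclideanSpace ℝ (Fin n)) (i : Fin n) : |x i| ≤ supNorm x :=
  le_ciSup (f := fun i => |x i|) (Set.finite_range _).bddAbove i

theorem inner_eq_sum_mul (x y : EuclideanSpace ℝ (Fin n)) : inner ℝ x y = ∑ i, y i * x i := by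
  simp [PiLp.inner_apply]

theorem inner_starProjection_self (S : Submodule ℝ (EuclideanSpace ℝ (Fin n)))
    (x : EuclideanSpace ℝ (Fin n)) :
    inner ℝ x (S.starProjection x) = ‖S.starProjection x‖ ^ 2 := by
  rw [← real_inner_self_eq_norm_sq, S.inner_starProjection_left_eq_right,
    Submodule.starProjection_eq_self_iff.2 (S.starProjection_apply_mem x)]

/-- The vectors of `S` with Euclidean norm at most `r` and coordinates bounded by `b`. -/
def box (S : Submodule ℝ (EuclideanSpace ℝ (Fin n))) (r b : ℝ) : Set S :=
  {v | ‖v‖ ≤ r ∧ ∀ i, |(v : EuclideanSpace ℝ (Fin n)) i| ≤ b}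

variable (S : Submodule ℝ (EuclideanSpace ℝ (Fin n)))

theorem isClosed_box (r b : ℝ) : IsClosed (box S r b) := by
  have h : box S r b
      = {v | ‖v‖ ≤ r} ∩ ⋂ i, {v : S | |(v : EuclideanSpace ℝ (Fin n)) i| ≤ b} := by
    ext v
    simp [box]
  rw [h]
  exact (isClosed_le continuous_norm continuous_const).inter
    (isClosed_iInter fun i => isClosed_le (by fun_prop) continuous_const)

theorem neg_mem_box {r b : ℝ} : ∀ v ∈ box S r b, -v ∈ box S r b := fun v hv =>
  ⟨by simpa using hv.1, fun i => by simpa using hv.2 i⟩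

theorem add_mem_box {r b r' b' : ℝ} {v w : S} (hv : v ∈ box S r b) (hw : w ∈ box S r' b') :
    v + w ∈ box S (r + r') (b + b') :=
  ⟨(norm_add_le _ _).trans (add_le_add hv.1 hw.1),
    fun i => (abs_add_le _ _).trans (add_le_add (hv.2 i) (hw.2 i))⟩

theorem ball_subset_box {r b : ℝ} : Metric.ball (0 : S) (min r b) ⊆ box S r b := fun v hv => by
  rw [mem_ball_zero_iff, lt_min_iff] at hv
  exact ⟨hv.1.le, fun i => (PiLp.norm_apply_le (v : EuclideanSpace ℝ (Fin n)) i).trans hv.2.le⟩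

open scoped Pointwise in
theorem box_subset_smul {r b a : ℝ} (ha : 0 < a) : box S (a * r) (a * b) ⊆ a • box S r b := by
  intro v hv
  rw [Set.mem_smul_set_iff_inv_smul_mem₀ ha.ne']
  refine ⟨?_, fun i => ?_⟩
  · rw [norm_smul, Real.norm_of_nonneg (by positivity), inv_mul_le_iff₀ ha]
    exact hv.1
  · rw [Submodule.coe_smul, PiLp.smul_apply, smul_eq_mul, abs_mul, abs_of_pos (inv_pos.2 ha),
      inv_mul_le_iff₀ ha]
    exact hv.2 i

theorem measure_norm_starProjection_ge_le {Ω : Type*} [MeasurableSpace Ω] (μ : Measure Ω)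
    [IsProbabilityMeasure μ] (ξ : Ω → EuclideanSpace ℝ (Fin n))
    (hξ : ∀ i, Measurable (fun ω => ξ ω i))
    (hindep : iIndepFun (fun (i : Fin n) (ω : Ω) => ξ ω i) μ) {σ c : ℝ} (hc : 0 ≤ c)
    (hbern : ∀ i, BernsteinLaplace μ (fun ω => ξ ω i) σ c) {ρ u L : ℝ} (hρ : 0 < ρ) (hu : 0 < u)
    (hL : 0 < L) (hLc : 4 * (L * u / ρ) * c ≤ 1) :
    μ {ω | ρ ≤ ‖S.starProjection (ξ ω)‖ ∧ supNorm (S.starProjection (ξ ω)) ≤ u}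
      ≤ ENNReal.ofReal (2 ^ Module.finrank ℝ S *
        Real.exp ((2 * L) ^ 2 * σ ^ 2 - L * ρ)) := by
  set b := L * u / ρ with hb
  have hb0 : 0 < b := by positivity
  let ν : Measure S := Measure.addHaar
  have hKpos : ν (box S L b) ≠ 0 := fun h =>
    (Metric.measure_ball_pos ν (0 : S) (lt_min hL hb0)).ne'
      (measure_mono_null (ball_subset_box S) h)
  have hKfin : ν (box S L b) ≠ ⊤ := by
    refine ((measure_mono (fun v hv => ?_)).trans_lt
      (measure_closedBall_lt_top (μ := ν) (x := (0 : S)) (r := L))).ne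
    simpa using hv.1
  refine measure_le_of_exists_shift μ ν (K := box S L b) (L := box S (2 * L) (2 * b)) (neg_mem_box S)
    hKpos hKfin (isClosed_box S _ _).measurableSet ?_
    (fun ω => (innerₛₗ ℝ (ξ ω)).comp S.subtype) ?_ ?_ ?_
  · refine (measure_mono (box_subset_smul S two_pos)).trans_eq ?_
    rw [Measure.addHaar_smul_of_nonneg _ two_pos.le]
  · simp only [LinearMap.comp_apply, innerₛₗ_apply_apply, Submodule.subtype_apply, inner_eq_sum_mul]
    refine Finset.measurable_fun_sum _ fun i _ => ?_
    refine Measurable.mul ?_ ((hξ i).comp measurable_fst)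
    exact (show Continuous fun v : S => (v : EuclideanSpace ℝ (Fin n)) i by
      fun_prop).measurable.comp measurable_snd
  · intro v hv
    simp only [LinearMap.comp_apply, innerₛₗ_apply_apply, Submodule.subtype_apply, inner_eq_sum_mul]
    -- `hLc` gives `2 * b * c ≤ 1 / 2`, so the denominator `2 * (1 - 2 * b * c)` is at least 1.
    refine (lintegral_exp_sum_le hξ hindep hc hbern (fun i => (v : EuclideanSpace ℝ (Fin n)) i)
      (M := 2 * b) hv.2 (by linarith)).trans ?_
    refine ENNReal.ofReal_le_ofReal (Real.exp_le_exp.2 ?_)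
    have hsum : ∑ i, (v : EuclideanSpace ℝ (Fin n)) i ^ 2 ≤ (2 * L) ^ 2 := by
      rw [← EuclideanSpace.real_norm_sq_eq]
      exact pow_le_pow_left₀ (norm_nonneg _) hv.1 2
    refine mul_le_mul hsum ?_ (by have : 2 * b * c ≤ 1 / 2 := by linarith
                                  exact div_nonneg (sq_nonneg _) (by linarith)) (sq_nonneg _)
    exact div_le_self (sq_nonneg _) (by linarith)
  · rintro ω ⟨hρω, huω⟩
    set y := S.starProjection (ξ ω) with hy
    have hy0 : 0 < ‖y‖ := hρ.trans_le hρω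
    -- Rescaling `y` to norm `L` makes its coordinates at most `L * u / ρ = b` and its pairing with
    -- `ξ ω` equal to `L * ‖y‖ ≥ L * ρ`.
    refine ⟨(L / ‖y‖) • ⟨y, S.starProjection_apply_mem _⟩, fun v hv => ?_, ?_⟩
    · rw [two_mul, two_mul]
      refine add_mem_box S ⟨?_, fun i => ?_⟩ hv
      · rw [norm_smul, Real.norm_of_nonneg (by positivity), Submodule.coe_norm,
          div_mul_cancel₀ _ hy0.ne']
      · rw [Submodule.coe_smul, PiLp.smul_apply, smul_eq_mul, abs_mul,
          abs_of_pos (by positivity), hb, mul_div_right_comm]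
        have := (abs_le_supNorm y i).trans huω
        gcongr
    · simp only [LinearMap.comp_apply, innerₛₗ_apply_apply, Submodule.subtype_apply,
        Submodule.coe_smul, inner_smul_right]
      rw [hy, inner_starProjection_self, ← hy, div_mul_eq_mul_div, sq, ← mul_assoc,
        mul_div_cancel_right₀ _ hy0.ne']
      gcongr

theorem measureReal_norm_sq_starProjection_ge_le {Ω : Type*} [MeasurableSpace Ω] (μ : Measure Ω)
    [IsProbabilityMeasure μ] (ξ : Ω → EuclideanSpace ℝ (Fin n))
    (hξ : ∀ i, Measurable (fun ω => ξ ω i))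
    (hindep : iIndepFun (fun (i : Fin n) (ω : Ω) => ξ ω i) μ) {σ c : ℝ} (hc : 0 ≤ c)
    (hbern : ∀ i, BernsteinLaplace μ (fun ω => ξ ω i) σ c) (hσc : 0 < σ ∨ 0 < c) {x u : ℝ}
    (hx : 0 < x) (hu : 0 < u) :
    μ.real {ω | kappa ^ 2 * (σ ^ 2 + 2 * c * u / kappa) * ((Module.finrank ℝ S : ℝ) + x)
          ≤ ‖S.starProjection (ξ ω)‖ ^ 2 ∧ supNorm (S.starProjection (ξ ω)) ≤ u}
      ≤ Real.exp (-x) := by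
  set D := Module.finrank ℝ S
  set N : ℝ := (D : ℝ) + x with hN
  set V : ℝ := σ ^ 2 + 2 * c * u / kappa with hV
  have hκ : kappa = 18 := rfl
  have hN0 : 0 < N := by positivity
  have hV0 : 0 < V := by
    rw [hV, hκ]
    rcases hσc with h | h
    · have : 0 ≤ 2 * c * u / 18 := by positivity
      positivity
    · have : 0 < 2 * c * u / 18 := by positivity
      positivity
  have hsV : 0 < √V := Real.sqrt_pos.2 hV0
  have hsN : 0 < √N := Real.sqrt_pos.2 hN0
  have hVV : √V ^ 2 = V := Real.sq_sqrt hV0.le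
  have hNN : √N ^ 2 = N := Real.sq_sqrt hN0.le
  have hcu : 2 * c * u ≤ 18 * V := by
    rw [hV, hκ]
    nlinarith [sq_nonneg σ]
  have hσV : σ ^ 2 ≤ V := by
    rw [hV, hκ]
    have : 0 ≤ 2 * c * u / 18 := by positivity
    linarith
  -- Here `ρ²` is the threshold, and `2L = √(N / V)` makes `(2L)²σ² ≤ N` and `Lρ = 9N`. The term
  -- `2cu/κ` in `V` is what the constraint on `L` requires.
  have hmain := measure_norm_starProjection_ge_le S μ ξ hξ hindep hc hbern
    (ρ := 18 * (√V * √N)) (u := u) (L := √N / √V / 2) (by positivity) hu (by positivity) (by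
      have : 4 * (√N / √V / 2 * u / (18 * (√V * √N))) * c = 2 * c * u / (18 * √V ^ 2) := by
        field_simp
        ring
      rw [this, hVV, div_le_one (by positivity)]
      exact hcu)
  refine ENNReal.toReal_le_of_le_ofReal (Real.exp_pos _).le
    ((measure_mono ?_).trans (hmain.trans (ENNReal.ofReal_le_ofReal ?_)))
  · rintro ω ⟨h₁, h₂⟩
    refine ⟨abs_le_of_sq_le_sq' ?_ (norm_nonneg _) |>.2, h₂⟩
    refine le_trans (le_of_eq ?_) h₁
    rw [mul_pow, mul_pow, hVV, hNN, hκ]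
    ring
  -- The total exponent is at most `D + N - 9N = -7D - 8x ≤ -x`.
  · have h2 : (2 : ℝ) ^ D ≤ Real.exp D := by
      rw [← Real.exp_one_pow]
      exact pow_le_pow_left₀ two_pos.le Real.exp_one_gt_two.le _
    refine (mul_le_mul_of_nonneg_right h2 (Real.exp_pos _).le).trans ?_
    rw [← Real.exp_add]
    refine Real.exp_le_exp.2 ?_
    have e₁ : (2 * (√N / √V / 2)) ^ 2 * σ ^ 2 ≤ N := by
      have : (2 * (√N / √V / 2)) ^ 2 * σ ^ 2 = √N ^ 2 * σ ^ 2 / √V ^ 2 := by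
        field_simp
      rw [this, hVV, hNN, div_le_iff₀ hV0]
      gcongr
    have e₂ : √N / √V / 2 * (18 * (√V * √N)) = 9 * √N ^ 2 := by
      field_simp
      ring
    rw [e₂, hNN]
    have : (D : ℝ) ≥ 0 := Nat.cast_nonneg _
    linarith

/-! ### Sup norm -/

theorem starProjection_apply_coord (x : EuclideanSpace ℝ (Fin n)) (i : Fin n) :
    S.starProjection x i
      = inner ℝ x (S.starProjection (EuclideanSpace.single i (1 : ℝ))) := by
  rw [← S.inner_starProjection_left_eq_right, EuclideanSpace.inner_single_right]
  simp

theorem norm_starProjection_single_le (i : Fin n) :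
    ‖S.starProjection (EuclideanSpace.single i (1 : ℝ))‖ ≤ Lambda2 S :=
  le_ciSup (f := fun i => ‖S.starProjection (EuclideanSpace.single i (1 : ℝ))‖)
    (Set.finite_range _).bddAbove i

theorem Lambda2_nonneg : 0 ≤ Lambda2 S := Real.iSup_nonneg fun _ => norm_nonneg _

/-- The entry is `⟪Π_S e_j, Π_S e_i⟫` since `Π_S` is a self-adjoint idempotent; Cauchy–Schwarz
applies. Thus `Λ₂²` controls both the squared norm and the coordinates. -/
theorem abs_starProjection_single_apply_le (i j : Fin n) :
    |S.starProjection (EuclideanSpace.single i (1 : ℝ)) j| ≤ Lambda2 S ^ 2 := by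
  rw [starProjection_apply_coord, ← Submodule.starProjection_eq_self_iff.2
    (S.starProjection_apply_mem (EuclideanSpace.single j (1 : ℝ))),
    ← S.inner_starProjection_left_eq_right, sq]
  refine (abs_real_inner_le_norm _ _).trans ?_
  exact mul_le_mul (norm_starProjection_single_le S i) (norm_starProjection_single_le S j)
    (norm_nonneg _) (Lambda2_nonneg S)

theorem measure_le_inner_le {Ω : Type*} [MeasurableSpace Ω] (μ : Measure Ω)
    [IsProbabilityMeasure μ] (ξ : Ω → EuclideanSpace ℝ (Fin n))
    (hξ : ∀ i, Measurable (fun ω => ξ ω i))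
    (hindep : iIndepFun (fun (i : Fin n) (ω : Ω) => ξ ω i) μ) {σ c : ℝ} (hσ : 0 < σ) (hc : 0 ≤ c)
    (hbern : ∀ i, BernsteinLaplace μ (fun ω => ξ ω i) σ c) {v : EuclideanSpace ℝ (Fin n)} {l : ℝ}
    (hl : 0 < l) (hv : ‖v‖ ^ 2 ≤ l) (hv' : ∀ i, |v i| ≤ l) {x : ℝ} (hx : 0 < x) :
    μ {ω | x ≤ inner ℝ (ξ ω) v}
      ≤ ENNReal.ofReal (Real.exp (-(x ^ 2 / (2 * l * (σ ^ 2 + c * x))))) := by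
  have hW : 0 < σ ^ 2 + c * x := by positivity
  -- With this `t` the Chernoff exponent becomes `t² * l * (σ² + c * x) / 2 - t * x = -t * x / 2`.
  set t := x / (l * (σ ^ 2 + c * x)) with ht
  have ht0 : 0 < t := by positivity
  have htl : 1 - t * l * c = σ ^ 2 / (σ ^ 2 + c * x) := by
    rw [ht]
    field_simp
    ring
  have hσW : 0 < σ ^ 2 / (σ ^ 2 + c * x) := by positivity
  have hexp := lintegral_exp_sum_le hξ hindep hc hbern (fun i => t * v i) (M := t * l)
    (fun i => by rw [abs_mul, abs_of_pos ht0]; exact mul_le_mul_of_nonneg_left (hv' i) ht0.le)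
    (by linarith)
  have hmeas : Measurable fun ω => ENNReal.ofReal (Real.exp (∑ i, t * v i * ξ ω i)) :=
    (Finset.measurable_fun_sum _ fun i _ => (hξ i).const_mul (t * v i)).exp.ennreal_ofReal
  have hmarkov := (mul_meas_ge_le_lintegral (μ := μ) hmeas (ENNReal.ofReal (Real.exp (t * x)))).trans
    hexp
  have hsub : {ω | x ≤ inner ℝ (ξ ω) v} ⊆ {ω | ENNReal.ofReal (Real.exp (t * x))
      ≤ ENNReal.ofReal (Real.exp (∑ i, t * v i * ξ ω i))} := fun ω hω => by
    refine ENNReal.ofReal_le_ofReal (Real.exp_le_exp.2 ?_)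
    simp only [mul_assoc, ← Finset.mul_sum]
    rw [← inner_eq_sum_mul]
    exact mul_le_mul_of_nonneg_left hω ht0.le
  refine (measure_mono hsub).trans ?_
  have hpos : 0 < Real.exp (t * x) := Real.exp_pos _
  refine (ENNReal.mul_le_mul_iff_right (by simpa using hpos) ENNReal.ofReal_ne_top).1
    (hmarkov.trans ?_)
  rw [← ENNReal.ofReal_mul hpos.le, ← Real.exp_add]
  refine ENNReal.ofReal_le_ofReal (Real.exp_le_exp.2 ?_)
  have hsum : ∑ i, (t * v i) ^ 2 ≤ t ^ 2 * l := by
    simp only [mul_pow, ← Finset.mul_sum]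
    rw [← EuclideanSpace.real_norm_sq_eq]
    gcongr
  rw [htl]
  refine (mul_le_mul_of_nonneg_right hsum (by positivity)).trans (le_of_eq ?_)
  rw [ht]
  field_simp
  ring

theorem exists_le_abs_of_le_supNorm (hn : 1 ≤ n) {y : EuclideanSpace ℝ (Fin n)} {x : ℝ}
    (h : x ≤ supNorm y) : ∃ i, x ≤ |y i| := by
  have : Nonempty (Fin n) := ⟨⟨0, hn⟩⟩
  obtain ⟨i, hi⟩ := exists_eq_ciSup_of_finite (f := fun i => |y i|)
  exact ⟨i, h.trans_eq hi.symm⟩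

theorem measureReal_supNorm_starProjection_ge_le {Ω : Type*} [MeasurableSpace Ω] (μ : Measure Ω)
    [IsProbabilityMeasure μ] (hn : 1 ≤ n) (ξ : Ω → EuclideanSpace ℝ (Fin n))
    (hξ : ∀ i, Measurable (fun ω => ξ ω i))
    (hindep : iIndepFun (fun (i : Fin n) (ω : Ω) => ξ ω i) μ) {σ c : ℝ} (hσ : 0 < σ) (hc : 0 ≤ c)
    (hbern : ∀ i, BernsteinLaplace μ (fun ω => ξ ω i) σ c) (hΛ : 0 < Lambda2 S) {x : ℝ}
    (hx : 0 < x) :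
    μ.real {ω | x ≤ supNorm (S.starProjection (ξ ω))}
      ≤ 2 * (n : ℝ) * Real.exp (-(x ^ 2 / (2 * Lambda2 S ^ 2 * (σ ^ 2 + c * x)))) := by
  set e := Real.exp (-(x ^ 2 / (2 * Lambda2 S ^ 2 * (σ ^ 2 + c * x)))) with he
  let w : Fin n → EuclideanSpace ℝ (Fin n) := fun i =>
    S.starProjection (EuclideanSpace.single i (1 : ℝ))
  have hsub : {ω | x ≤ supNorm (S.starProjection (ξ ω))}
      ⊆ ⋃ i, ({ω | x ≤ inner ℝ (ξ ω) (w i)} ∪ {ω | x ≤ inner ℝ (ξ ω) (-w i)}) := fun ω hω => by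
    obtain ⟨i, hi⟩ := exists_le_abs_of_le_supNorm hn hω
    rw [starProjection_apply_coord, le_abs] at hi
    refine Set.mem_iUnion.2 ⟨i, hi.imp id fun h => ?_⟩
    simpa [inner_neg_right] using h
  have hw : ∀ i, ‖w i‖ ^ 2 ≤ Lambda2 S ^ 2 := fun i =>
    pow_le_pow_left₀ (norm_nonneg _) (norm_starProjection_single_le S i) 2
  have h₁ : ∀ i, μ {ω | x ≤ inner ℝ (ξ ω) (w i)} ≤ ENNReal.ofReal e := fun i =>
    measure_le_inner_le μ ξ hξ hindep hσ hc hbern (by positivity) (hw i)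
      (abs_starProjection_single_apply_le S i) hx
  have h₂ : ∀ i, μ {ω | x ≤ inner ℝ (ξ ω) (-w i)} ≤ ENNReal.ofReal e := fun i =>
    measure_le_inner_le μ ξ hξ hindep hσ hc hbern (by positivity) (by rw [norm_neg]; exact hw i)
      (fun j => by rw [PiLp.neg_apply, abs_neg]; exact abs_starProjection_single_apply_le S i j) hx
  have he0 : 0 ≤ e := (Real.exp_pos _).le
  refine ENNReal.toReal_le_of_le_ofReal (by positivity) ?_
  calc μ {ω | x ≤ supNorm (S.starProjection (ξ ω))}
      ≤ ∑ i, μ ({ω | x ≤ inner ℝ (ξ ω) (w i)} ∪ {ω | x ≤ inner ℝ (ξ ω) (-w i)}) :=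
        (measure_mono hsub).trans (measure_iUnion_fintype_le _ _)
    _ ≤ ∑ _i : Fin n, ENNReal.ofReal (2 * e) := by
        refine Finset.sum_le_sum fun i _ => (measure_union_le _ _).trans ?_
        rw [two_mul, ENNReal.ofReal_add he0 he0]
        exact add_le_add (h₁ i) (h₂ i)
    _ = ENNReal.ofReal (2 * n * e) := by
        rw [Finset.sum_const, Finset.card_univ, Fintype.card_fin, nsmul_eq_mul,
          ← ENNReal.ofReal_natCast, ← ENNReal.ofReal_mul (Nat.cast_nonneg _)]
        congr 1
        ring

/-! ### Degenerate cases: `Π_S ξ = 0` almost surely -/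

theorem measureReal_supNorm_eq_zero_of_ae {Ω : Type*} [MeasurableSpace Ω] {μ : Measure Ω}
    {Y : Ω → EuclideanSpace ℝ (Fin n)} (hn : 1 ≤ n) (hY : ∀ᵐ ω ∂μ, Y ω = 0) {x : ℝ} (hx : 0 < x) :
    μ.real {ω | x ≤ supNorm (Y ω)} = 0 := by
  have : μ {ω | x ≤ supNorm (Y ω)} = 0 := by
    refine measure_mono_null (fun ω hω => ?_) (ae_iff.1 hY)
    intro h0
    obtain ⟨i, hi⟩ := exists_le_abs_of_le_supNorm hn hω
    rw [h0] at hi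
    simp only [PiLp.zero_apply, abs_zero] at hi
    exact hx.not_ge hi
  simp [Measure.real, this]

theorem starProjection_eq_zero_of_Lambda2_eq_zero (h : Lambda2 S = 0)
    (x : EuclideanSpace ℝ (Fin n)) : S.starProjection x = 0 := by
  ext i
  have hi : S.starProjection (EuclideanSpace.single i (1 : ℝ)) = 0 :=
    norm_le_zero_iff.1 ((norm_starProjection_single_le S i).trans_eq h)
  rw [starProjection_apply_coord, hi, inner_zero_right, PiLp.zero_apply]

theorem starProjection_ae_eq_zero {Ω : Type*} [MeasurableSpace Ω] {μ : Measure Ω}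
    [IsProbabilityMeasure μ] {ξ : Ω → EuclideanSpace ℝ (Fin n)} {c : ℝ} (hc : 0 ≤ c)
    (hbern : ∀ i, BernsteinLaplace μ (fun ω => ξ ω i) 0 c) :
    ∀ᵐ ω ∂μ, S.starProjection (ξ ω) = 0 := by
  filter_upwards [ae_all_iff.2 fun i => (hbern i).ae_eq_zero hc] with ω hω
  have : ξ ω = 0 := by
    ext i
    exact hω i
  rw [this, map_zero]

end ChiDeviation


theorem mainTheorem4 {Ω : Type*} [MeasurableSpace Ω] (μ : Measure Ω) [IsProbabilityMeasure μ]
    (n : ℕ) (hn : 1 ≤ n) (D : ℕ)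
    (S : Submodule ℝ (EuclideanSpace ℝ (Fin n))) (hD : Module.finrank ℝ S = D)
    (ξ : Ω → EuclideanSpace ℝ (Fin n)) (hξ : ∀ i, Measurable (fun ω => ξ ω i))
    (hindep : iIndepFun (fun (i : Fin n) (ω : Ω) => ξ ω i) μ)
    (σ c : ℝ) (hσ : 0 ≤ σ) (hc : 0 ≤ c)
    (hbern : ∀ i, ChiDeviation.BernsteinLaplace μ (fun ω => ξ ω i) σ c) :
    -- deviations of the Euclidean norm, on the event where the sup norm is at most `u`
    (0 < σ ∨ 0 < c → ∀ x u : ℝ, 0 < x → 0 < u →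
      μ.real {ω | ChiDeviation.kappa ^ 2 * (σ ^ 2 + 2 * c * u / ChiDeviation.kappa) * ((D : ℝ) + x)
              ≤ ‖S.starProjection (ξ ω)‖ ^ 2 ∧
            ChiDeviation.supNorm (S.starProjection (ξ ω)) ≤ u}
        ≤ Real.exp (-x)) ∧
    -- deviations of the sup norm; a zero denominator makes the right-hand side `exp (-∞) = 0`
    (∀ x : ℝ, 0 < x →
      (0 < ChiDeviation.Lambda2 S ^ 2 * (σ ^ 2 + c * x) →
        μ.real {ω | x ≤ ChiDeviation.supNorm (S.starProjection (ξ ω))}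
          ≤ 2 * (n : ℝ) *
            Real.exp (-(x ^ 2 / (2 * ChiDeviation.Lambda2 S ^ 2 * (σ ^ 2 + c * x))))) ∧
      (ChiDeviation.Lambda2 S ^ 2 * (σ ^ 2 + c * x) = 0 →
        μ.real {ω | x ≤ ChiDeviation.supNorm (S.starProjection (ξ ω))} = 0)) := by
  refine ⟨fun h x u hx hu => ?_, fun x hx => ⟨fun h => ?_, fun h => ?_⟩⟩
  · subst hD
    exact ChiDeviation.measureReal_norm_sq_starProjection_ge_le S μ ξ hξ hindep hc hbern h hx hu
  -- For `σ = 0` the Chernoff parameter would reach the excluded boundary `t * l * c = 1`, but then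
  -- `ξ` vanishes almost surely.
  · rcases hσ.eq_or_lt with rfl | hσ'
    · rw [ChiDeviation.measureReal_supNorm_eq_zero_of_ae hn
        (ChiDeviation.starProjection_ae_eq_zero S hc hbern) hx]
      positivity
    · have hΛ : 0 < ChiDeviation.Lambda2 S :=
        (ChiDeviation.Lambda2_nonneg S).lt_of_ne fun h0 => by simp [← h0] at h
      exact ChiDeviation.measureReal_supNorm_starProjection_ge_le S μ hn ξ hξ hindep hσ' hc hbern
        hΛ hx
  · refine ChiDeviation.measureReal_supNorm_eq_zero_of_ae hn ?_ hx
    rcases mul_eq_zero.1 h with h | h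
    · exact ae_of_all _ fun ω =>
        ChiDeviation.starProjection_eq_zero_of_Lambda2_eq_zero S (pow_eq_zero_iff two_ne_zero |>.1 h) _
    · have hσ0 : σ = 0 := by
        have : 0 ≤ c * x := by positivity
        exact pow_eq_zero_iff two_ne_zero |>.1 (le_antisymm (by linarith) (sq_nonneg σ))
      subst hσ0
      exact ChiDeviation.starProjection_ae_eq_zero S hc hbern
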